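/- Let $\mathbb{K}$ be a field and let $G$ be a finite simple graph on a non-empty vertex set $X=\{x_1,\dots,x_n\}$. Let $R=\mathbb{K}[x_1,\dots,x_n]$ with graded maximal ideal $M=(x_1,\dots,x_n)$. Let $\Delta_G$ be the independence complex of $G$ (the simplicial complex on $X$ whose faces are the independent sets of $G$, the empty set included), let $I_{\Delta_G}\subseteq R$ be its Stanley--Reisner ideal, generated by the squarefree monomials $\prod_{x_i\in F}x_i$ with $F$ a minimal non-face, and let $\mathbb{K}[\Delta_G]=R/I_{\Delta_G}$. For an $R$-module $N$ let $\operatorname{depth}N$ be the supremum of the lengths of $N$-regular sequences in $M$, and let the initial dimension be $\operatorname{indim}N=\inf\{\dim R/P\mid P\in\operatorname{Ass}_RN\}$. A finitely generated graded $R$-module $N$ is initially Cohen--Macaulay if $N=0$ or $\operatorname{depth}N=\operatorname{indim}N$, and $\Delta_G$ is called initially Cohen--Macaulay (over $\mathbb{K}$) if the $R$-module $\mathbb{K}[\Delta_G]$ is. A facet of $\Delta_G$ is an inclusion-maximal face, a minimum facet is a facet of minimum cardinality among all facets, and a free vertex is a vertex that belongs to exactly one facet. Proposition. The projective dimension $\operatorname{pdim}_R\mathbb{K}[\Delta_G]$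 equals the maximum vertex degree of $G$ if and only if $\Delta_G$ is initially Cohen--Macaulay over $\mathbb{K}$ and has a minimum facet containing a free vertex. -/

import Mathlib

namespace InitiallyCM

section Algebra

variable {R : Type*} [CommRing R]

/-- The `I`-depth of an `R`-module `N`: the supremum of the lengths of the `N`-regular sequences
contained in `I`. A sequence `r₁, …, r_d` is `N`-regular here if each `r_i` is a nonzerodivisor on
`N / (r₁, …, r_{i-1}) N`. If `N = I N` the value is `⊤` (usual convention); if `R` is Noetherian,
`N` is finitely generated and `N ≠ I N`, it is the common length of all maximal regular sequences
in `I`. -/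
noncomputable def depth (I : Ideal R) (N : Type*) [AddCommGroup N] [Module R N] : ℕ∞ :=
  ⨆ (rs : List R) (_ : (∀ r ∈ rs, r ∈ I) ∧ RingTheory.Sequence.IsWeaklyRegular N rs),
    (rs.length : ℕ∞)

variable (R) in
/-- The initial dimension of an `R`-module `N`: the infimum of the coheights `dim R ⧸ P` of the
associated primes `P` of `N`. -/
noncomputable def indim (N : Type*) [AddCommGroup N] [Module R N] : WithBot ℕ∞ :=
  ⨅ P ∈ associatedPrimes R N, ringKrullDim (R ⧸ P)

/-- A module `N` is initially Cohen-Macaulay with respect to `m` if `N = 0` or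
`depth N = indim N`, the depth being taken in `m`. Here `m` is the maximal ideal of a Noetherian
local ring `R` (and `N` is finitely generated) or the unique graded maximal ideal of a standard
graded algebra `R` over a field (and `N` is finitely generated and graded). -/
def IsInitiallyCohenMacaulay (m : Ideal R) (N : Type*) [AddCommGroup N] [Module R N] : Prop :=
  Subsingleton N ∨ (depth m N : WithBot ℕ∞) = indim R N

end Algebra

/-- A simplicial complex on the vertex set `V`: a family of finite subsets of `V` (the faces)
closed under taking subsets. The empty set counts as a face; not every vertex has to be a face. -/
structure Complex (V : Type*) where
  /-- The faces, including the empty face (unless there are no faces at all). -/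
  faces : Set (Finset V)
  down_closed : ∀ ⦃F F' : Finset V⦄, F ∈ faces → F' ⊆ F → F' ∈ faces

namespace Complex

variable {V : Type*} (Δ : Complex V)

/-- A facet is a face that is maximal with respect to inclusion. -/
def IsFacet (F : Finset V) : Prop :=
  Maximal (fun F' => F' ∈ Δ.faces) F

/-- A minimum facet is a facet of minimum cardinality among all facets. -/
def IsMinimumFacet (F : Finset V) : Prop :=
  Δ.IsFacet F ∧ ∀ F', Δ.IsFacet F' → F.card ≤ F'.card

/-- A free vertex is a vertex that belongs to exactly one facet. -/
def IsFreeVertex (x : V) : Prop :=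
  ∃! F, Δ.IsFacet F ∧ x ∈ F

variable (K : Type*) [Field K]

/-- The Stanley-Reisner ideal, generated by the squarefree monomials of the minimal non-faces. -/
noncomputable def stanleyReisnerIdeal : Ideal (MvPolynomial V K) :=
  Ideal.span {p | ∃ F : Finset V, Minimal (fun F' => F' ∉ Δ.faces) F ∧
    p = ∏ x ∈ F, MvPolynomial.X x}

/-- The Stanley-Reisner ring `K[Δ]`, the quotient of the polynomial ring by the Stanley-Reisner
ideal. -/
abbrev StanleyReisnerRing : Type _ :=
  MvPolynomial V K ⧸ Δ.stanleyReisnerIdeal K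

/-- The complex `Δ` is initially Cohen-Macaulay over `K` if `K[Δ]` is initially Cohen-Macaulay as
a graded module over the polynomial ring, with respect to the graded maximal ideal generated by
the variables. -/
def IsInitiallyCohenMacaulay : Prop :=
  InitiallyCM.IsInitiallyCohenMacaulay
    (Ideal.span (Set.range (MvPolynomial.X : V → MvPolynomial V K))) (Δ.StanleyReisnerRing K)

/-- The projective dimension of `K[Δ]` as a module over the polynomial ring. -/
noncomputable def pdim : WithBot ℕ∞ :=
  CategoryTheory.projectiveDimension
    (ModuleCat.of (MvPolynomial V K) (Δ.StanleyReisnerRing K))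

end Complex

/-- The independence complex of a graph: its faces are the independent sets of vertices. -/
def independenceComplex {V : Type*} (G : SimpleGraph V) : Complex V where
  faces := {F | G.IsIndepSet (F : Set V)}
  down_closed := fun _ _ hF hsub => Set.Pairwise.mono (Finset.coe_subset.mpr hsub) hF

end InitiallyCM

/-!
The argument compares three numbers with `p = pdim K[Δ]`, where `n` is the number of vertices, `R`
the polynomial ring with maximal ideal `M = (x₁, …, xₙ)`, and `b = n - |F|` for a minimum facet `F`
of the independence complex `Δ`.

* Each vertex `x` lies in a facet, which avoids the neighbours of `x`. Hence the maximum degree is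
  at most `b`, and equality means that some minimum facet is the complement of the neighbourhood of one
  of its vertices, that is, it contains a free vertex (`exists_isFreeVertex_iff_maxDegree_eq`).
* `b ≤ p` (`Complex.not_hasProjectiveDimensionLT_of_isFacet`): near the point where the variables
  in `F` are one and the others zero, `K[Δ]` looks like `R` modulo the `b` variables outside `F`,
  and those form a regular sequence. Comparing `Ext` into the residue field of that point avoids any
  localization.
* `depth K[Δ] = n - p`, the Auslander–Buchsbaum formula (`Complex.depth_stanleyReisnerRing`), while
  the initial dimension is `n - b` (`Complex.indim_stanleyReisnerRing`). So `Δ` is initially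
  Cohen–Macaulay if and only if `p = b`.

As the maximum degree is at most `b` and `b ≤ p`, it equals `p` if and only if both inequalities are
equalities.

The Auslander–Buchsbaum formula rests on Hilbert's syzygy theorem
(`hasProjectiveDimensionLE_mvPolynomial`), which follows from the sequence
`0 → A[X] ⊗ N → A[X] ⊗ N → N → 0` for `A[X]`-modules `N`. If `p < n`, then `R ⧸ M`, of projective
dimension `n`, cannot embed in the module, so `M` contains a regular element; dividing by it raises
`p` by at most one, and iterating gives `n - p ≤ depth`. Conversely, for `T` killed by `M`, dividing
by a regular element of `M` shifts the vanishing of `Ext (-, T)` by one degree, so a regular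
sequence of length `d` forces `Ext^q (N, T) = 0` for `q + d > n`. For graded `N`, a minimal free cover
(`NatGrading.exists_minimal_cover`) and dimension shifting turn this into `pdim N < q`. Gradedness
matters only there: it makes Nakayama's lemma available for the non-local ring `R`.
-/

open CategoryTheory Abelian RingTheory.Sequence

namespace InitiallyCM

universe w u v

/-! ### Ext groups and regular sequences -/

section ExtRegular

variable {R : Type w} [CommRing R]

lemma mk₀_smul_id_comp {N T : ModuleCat.{w} R} {j : ℕ} (r : R) (e : Ext N T j) :
    (Ext.mk₀ (r • 𝟙 N)).comp e (zero_add j) = r • e := by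
  rw [Ext.mk₀_smul, Ext.smul_comp, Ext.mk₀_id_comp]

lemma ext_smul_of_forall_smul_eq {N T : ModuleCat.{w} R} {j : ℕ} {r s : R}
    (h : ∀ t : T, r • t = s • t) (e : Ext N T j) : r • e = s • e := by
  rw [Ext.smul_eq_comp_mk₀, Ext.smul_eq_comp_mk₀]
  congr 2
  ext t
  exact h t

/-- Multiplication by `r` on `Ext N T j` is zero, so the connecting map
`Ext N T j → Ext (N ⧸ r N) T (j + 1)` is injective. -/
lemma subsingleton_ext_of_quotSMulTop {N T : ModuleCat.{w} R} {r : R}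
    (hr : IsSMulRegular N r) (hT : ∀ t : T, r • t = 0) {j : ℕ}
    (h : Subsingleton (Ext (ModuleCat.of R (QuotSMulTop r N)) T (j + 1))) :
    Subsingleton (Ext N T j) := by
  refine subsingleton_of_forall_eq 0 fun e => ?_
  obtain ⟨x, hx⟩ := Ext.contravariant_sequence_exact₁ hr.smulShortComplex_shortExact T e
    (add_comm 1 j) (h.elim _ _)
  have h0 : r • (show Ext N T j from x) = 0 := by
    rw [ext_smul_of_forall_smul_eq (s := 0) (fun t => by rw [hT t, zero_smul]), zero_smul]
  exact hx.symm.trans ((mk₀_smul_id_comp (N := N) r x).trans h0)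

lemma subsingleton_ext_of_linearEquiv {N N' T : ModuleCat.{w} R} (e : N ≃ₗ[R] N') {j : ℕ}
    (h : Subsingleton (Ext N T j)) : Subsingleton (Ext N' T j) := by
  refine subsingleton_of_forall_eq 0 fun x => ?_
  have h0 : (Ext.mk₀ e.toModuleIso.hom).comp x (zero_add j) = 0 := h.elim _ _
  rw [← x.mk₀_id_comp, ← e.toModuleIso.inv_hom_id, ← Ext.mk₀_comp_mk₀_assoc, h0, Ext.comp_zero]

lemma subsingleton_ext_of_quotient_ofList {N T : ModuleCat.{w} R} {rs : List R}
    (hrs : IsWeaklyRegular N rs) (hT : ∀ r ∈ rs, ∀ t : T, r • t = 0) {j : ℕ}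
    (h : Subsingleton (Ext (ModuleCat.of R (N ⧸ (Ideal.ofList rs • ⊤ : Submodule R N))) T
      (j + rs.length))) :
    Subsingleton (Ext N T j) := by
  induction rs generalizing N j with
  | nil =>
    exact subsingleton_ext_of_linearEquiv (N := ModuleCat.of R _)
      (Submodule.quotEquivOfEqBot _ (by simp)) h
  | cons r rs ih =>
    rw [isWeaklyRegular_cons_iff] at hrs
    refine subsingleton_ext_of_quotSMulTop hrs.1 (hT r (by simp))
      (ih (N := ModuleCat.of R (QuotSMulTop r N)) hrs.2 (fun s hs => hT s (by simp [hs])) ?_)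
    rw [show j + 1 + rs.length = j + (r :: rs).length by simp; omega]
    exact subsingleton_ext_of_linearEquiv
      (Submodule.quotOfListConsSMulTopEquivQuotSMulTopInner N r rs) h

end ExtRegular

/-! ### Hilbert's syzygy theorem -/

section Hilbert

open Polynomial TensorProduct

variable {A : Type w} [CommRing A]

/-- Flat base change does not increase the projective dimension. -/
lemma hasProjectiveDimensionLE_tensorProduct {B : Type w} [CommRing B] [Algebra A B]
    [Module.Flat A B] (n : ℕ) (N : Type w) [AddCommGroup N] [Module A N]
    (h : HasProjectiveDimensionLE (ModuleCat.of A N) n) :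
    HasProjectiveDimensionLE (ModuleCat.of B (B ⊗[A] N)) n := by
  induction n generalizing N with
  | zero =>
    simp only [HasProjectiveDimensionLE, zero_add] at h ⊢
    rw [← projective_iff_hasProjectiveDimensionLT_one, ← IsProjective.iff_projective] at h ⊢
    infer_instance
  | succ n ih =>
    let S := (ModuleCat.of A N).projectiveShortComplex
    have hS : S.ShortExact := (ModuleCat.of A N).shortExact_projectiveShortComplex
    let f : S.X₁ →ₗ[A] S.X₂ := S.f.hom
    let g : S.X₂ →ₗ[A] N := S.g.hom
    have hfg : Function.Exact f g :=
      (ShortComplex.ShortExact.moduleCat_exact_iff_function_exact S).mp hS.exact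
    have hf : Function.Injective f := hS.moduleCat_injective_f
    have hg : Function.Surjective g := hS.moduleCat_surjective_g
    have hfgB : Function.Exact (f.baseChange B) (g.baseChange B) := lTensor_exact B hfg hg
    let SB : ShortComplex (ModuleCat.{w} B) :=
      ModuleCat.shortComplexOfCompEqZero _ _ hfgB.linearMap_comp_eq_zero
    have hSB : SB.ShortExact := ModuleCat.shortComplex_shortExact SB hfgB
      (Module.Flat.lTensor_preserves_injective_linearMap f hf) (LinearMap.lTensor_surjective B hg)
    have : Projective SB.X₂ := by
      rw [← IsProjective.iff_projective]
      exact inferInstanceAs (Module.Projective B (B ⊗[A] S.X₂))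
    have hX₁ := (hS.hasProjectiveDimensionLT_X₃_iff n inferInstance).mp h
    exact (hSB.hasProjectiveDimensionLT_X₃_iff n this).mpr (ih S.X₁ hX₁)

variable (N : Type w) [AddCommGroup N] [Module A N] [Module A[X] N] [IsScalarTower A A[X] N]

/-- For an `A[X]`-module `N`, the endomorphism `p ⊗ n ↦ X p ⊗ n - p ⊗ X n` of `A[X] ⊗[A] N`. -/
noncomputable def tensorXSub : A[X] ⊗[A] N →ₗ[A[X]] A[X] ⊗[A] N :=
  (X : A[X]) • LinearMap.id - (LinearMap.lsmul A[X] N X |>.restrictScalars A).baseChange A[X]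

/-- For an `A[X]`-module `N`, the multiplication map `p ⊗ n ↦ p n` from `A[X] ⊗[A] N` to `N`. -/
noncomputable def tensorMul : A[X] ⊗[A] N →ₗ[A[X]] N :=
  (LinearMap.id : N →ₗ[A] N).liftBaseChange A[X]

variable {N}

lemma tensorXSub_tmul (p : A[X]) (n : N) :
    tensorXSub N (p ⊗ₜ[A] n) = (X * p) ⊗ₜ[A] n - p ⊗ₜ[A] ((X : A[X]) • n) := by
  simp [tensorXSub, smul_tmul']

lemma tensorMul_tmul (p : A[X]) (n : N) : tensorMul N (p ⊗ₜ[A] n) = p • n := by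
  simp [tensorMul]

lemma tensorMul_surjective : Function.Surjective (tensorMul (A := A) N) :=
  fun n => ⟨1 ⊗ₜ n, by rw [tensorMul_tmul, one_smul]⟩

/-- Modulo the image of `tensorXSub`, every element has the form `1 ⊗ n`; this gives exactness. -/
lemma tmul_sub_one_tmul_smul_mem_range (p : A[X]) (n : N) :
    p ⊗ₜ[A] n - 1 ⊗ₜ[A] (p • n) ∈ LinearMap.range (tensorXSub (A := A) N) := by
  induction p using Polynomial.induction_on' with
  | add p q hp hq =>
    convert! add_mem hp hq using 1
    rw [TensorProduct.add_tmul, add_smul, TensorProduct.tmul_add]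
    abel
  | monomial k a =>
    induction k generalizing n with
    | zero =>
      rw [monomial_zero_left, C_eq_algebraMap, algebraMap_smul, Algebra.algebraMap_eq_smul_one,
        smul_tmul, sub_self]
      exact zero_mem _
    | succ k ih =>
      convert! add_mem (ih ((X : A[X]) • n)) ⟨monomial k a ⊗ₜ n, tensorXSub_tmul _ _⟩ using 1
      rw [smul_smul, monomial_mul_X, X_mul_monomial]
      abel

lemma exact_tensorXSub_tensorMul :
    Function.Exact (tensorXSub (A := A) N) (tensorMul (A := A) N) := by
  intro t
  constructor
  · intro ht
    have key : t - 1 ⊗ₜ[A] tensorMul N t ∈ LinearMap.range (tensorXSub (A := A) N) := by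
      clear ht
      induction t with
      | zero => simp
      | tmul p n => rw [tensorMul_tmul]; exact tmul_sub_one_tmul_smul_mem_range p n
      | add s t hs ht =>
        convert! add_mem hs ht using 1
        rw [map_add, TensorProduct.tmul_add]
        abel
    simpa [ht] using key
  · rintro ⟨s, rfl⟩
    induction s with
    | zero => simp
    | tmul p n => rw [tensorXSub_tmul, map_sub, tensorMul_tmul, tensorMul_tmul, smul_smul, mul_comm,
        sub_self]
    | add s t hs ht => rw [map_add, map_add, hs, ht, add_zero]

/-- Comparing coefficients gives `m_j = X m_{j+1}`, hence `m_j = X^k m_{j+k} = 0` for large `k`. -/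
lemma polynomialModule_eq_zero_of_X_smul_eq (m : PolynomialModule A N)
    (h : (X : A[X]) • m =
      PolynomialModule.map A (LinearMap.lsmul A[X] N X |>.restrictScalars A) m) : m = 0 := by
  have hcoeff (q : PolynomialModule A N) (j : ℕ) : ((X : A[X]) • q).coeff (j + 1) = q.coeff j := by
    rw [← monomial_one_one_eq_X, PolynomialModule.monomial_smul_apply]
    simp
  have hmap (q : PolynomialModule A N) (j : ℕ) :
      (PolynomialModule.map A (LinearMap.lsmul A[X] N X |>.restrictScalars A) q).coeff j =
        (X : A[X]) • q.coeff j := by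
    induction q using PolynomialModule.induction_linear with
    | zero => simp
    | add p q hp hq => simp [hp, hq]
    | single i n => simp [PolynomialModule.map_single, Finsupp.single_apply]
  have hstep (j : ℕ) : m.coeff j = (X : A[X]) • m.coeff (j + 1) := by
    rw [← hcoeff, h, hmap]
  have hpow (k j : ℕ) : m.coeff j = (X : A[X]) ^ k • m.coeff (j + k) := by
    induction k with
    | zero => simp
    | succ k ih => rw [ih, hstep (j + k), smul_smul, pow_succ, add_assoc]
  rw [← PolynomialModule.coeff_eq_zero]
  ext j
  rw [hpow (m.coeff.support.sup id + 1) j, Finsupp.notMem_support_iff.mp, smul_zero,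
    Finsupp.zero_apply]
  intro hj
  have := Finset.le_sup (f := id) hj
  simp only [id] at this
  omega

lemma tensorXSub_injective : Function.Injective (tensorXSub (A := A) N) := by
  rw [← LinearMap.ker_eq_bot, LinearMap.ker_eq_bot']
  intro t ht
  let e := PolynomialModule.polynomialTensorProductLEquivPolynomialModule A N
  have he (t : A[X] ⊗[A] N) :
      e ((LinearMap.lsmul A[X] N X |>.restrictScalars A).baseChange A[X] t) =
        PolynomialModule.map A (LinearMap.lsmul A[X] N X |>.restrictScalars A) (e t) := by
    induction t with
    | zero => simp
    | tmul p n =>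
      simp [e, PolynomialModule.polynomialTensorProductLEquivPolynomialModule,
        PolynomialModule.map_smul]
    | add s t hs ht => rw [map_add, map_add, map_add, map_add, hs, ht]
  rw [← e.map_eq_zero_iff]
  apply polynomialModule_eq_zero_of_X_smul_eq
  rw [← he, ← map_smul, ← sub_eq_zero, ← map_sub, e.map_eq_zero_iff]
  exact ht

/-- If all `A`-modules have projective dimension at most `n`, then all `A[X]`-modules have
projective dimension at most `n + 1`, by the exact sequence
`0 → A[X] ⊗ N → A[X] ⊗ N → N → 0`. -/
lemma hasProjectiveDimensionLE_polynomial {n : ℕ}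
    (h : ∀ N : ModuleCat.{w} A, HasProjectiveDimensionLE N n) (N : ModuleCat.{w} A[X]) :
    HasProjectiveDimensionLE N (n + 1) := by
  let : Module A N := Module.compHom N (C : A →+* A[X])
  have : IsScalarTower A A[X] N := ⟨fun a p x => by
    rw [← C_mul', mul_smul]; rfl⟩
  let S : ShortComplex (ModuleCat.{w} A[X]) := ModuleCat.shortComplexOfCompEqZero _ _
    (exact_tensorXSub_tensorMul (A := A) (N := N)).linearMap_comp_eq_zero
  have hS : S.ShortExact := ModuleCat.shortComplex_shortExact S exact_tensorXSub_tensorMul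
    tensorXSub_injective tensorMul_surjective
  have h₁ : HasProjectiveDimensionLE (ModuleCat.of A[X] (A[X] ⊗[A] N)) n :=
    hasProjectiveDimensionLE_tensorProduct n N (h _)
  exact hS.hasProjectiveDimensionLT_X₃ (n + 1) h₁
    (hasProjectiveDimensionLT_of_ge _ (n + 1) _ (by omega))

lemma forall_hasProjectiveDimensionLE_of_ringEquiv {R S : Type*} [CommRing R] [CommRing S]
    [Small.{w} R] [Small.{w} S] (e : R ≃+* S) {n : ℕ}
    (h : ∀ N : ModuleCat.{w} R, HasProjectiveDimensionLE N n) (N : ModuleCat.{w} S) :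
    HasProjectiveDimensionLE N n := by
  let : Module R N := Module.compHom N (e : R →+* S)
  let := RingHomInvPair.of_ringEquiv e
  let := RingHomInvPair.of_ringEquiv e.symm
  have := h (ModuleCat.of R N)
  exact ModuleCat.hasProjectiveDimensionLE_of_semiLinearEquiv.{w, w} e (M := ModuleCat.of R N)
    { AddEquiv.refl N with map_smul' := fun r x => rfl } n

/-- **Hilbert's syzygy theorem**: modules over a polynomial ring in `n` variables over a field have
projective dimension at most `n`. -/
theorem hasProjectiveDimensionLE_mvPolynomial (V : Type u) [Finite V] (K : Type v) [Field K]
    (N : ModuleCat.{max u v} (MvPolynomial V K)) : HasProjectiveDimensionLE N (Nat.card V) := by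
  revert N
  induction V using Finite.induction_empty_option with
  | of_equiv e ih =>
    rw [← Nat.card_congr e]
    exact forall_hasProjectiveDimensionLE_of_ringEquiv.{max u v}
      (MvPolynomial.renameEquiv K e).toRingEquiv ih
  | h_empty =>
    refine forall_hasProjectiveDimensionLE_of_ringEquiv.{max u v}
      (MvPolynomial.isEmptyRingEquiv K PEmpty.{u + 1}).symm fun N => ?_
    simp only [HasProjectiveDimensionLE, Nat.card_of_isEmpty, zero_add]
    rw [← projective_iff_hasProjectiveDimensionLT_one, ← IsProjective.iff_projective]
    have : Module.Free K N := Module.Free.of_divisionRing K N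
    exact Module.Projective.of_free
  | h_option ih =>
    rename_i V _
    rw [Finite.card_option]
    exact forall_hasProjectiveDimensionLE_of_ringEquiv.{max u v}
      (MvPolynomial.optionEquivLeft K V).symm.toRingEquiv (hasProjectiveDimensionLE_polynomial ih)

end Hilbert

/-! ### Ideals generated by variables -/

section Variables

open MvPolynomial

variable {V : Type u} {K : Type v} [Field K]

lemma ker_killCompl {W : Type*} {f : W → V} (hf : Function.Injective f) :
    RingHom.ker (killCompl (R := K) hf) = Ideal.span (X '' (Set.range f)ᶜ) := by
  have hX (v : V) (hv : v ∉ Set.range f) : killCompl (R := K) hf (X v) = 0 := by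
    simp only [killCompl, aeval_X, dif_neg hv]
  apply le_antisymm
  · intro p hp
    have key (p : MvPolynomial V K) :
        p - rename f (killCompl hf p) ∈ Ideal.span (X (R := K) '' (Set.range f)ᶜ) := by
      induction p using MvPolynomial.induction_on with
      | C a => simp
      | add p q hp hq =>
        rw [map_add, map_add, add_sub_add_comm]
        exact add_mem hp hq
      | mul_X p v hp =>
        rw [map_mul, map_mul]
        by_cases hv : v ∈ Set.range f
        · obtain ⟨w, rfl⟩ := hv
          rw [← rename_X (R := K) f w, killCompl_rename_app, ← sub_mul]
          exact Ideal.mul_mem_right _ _ hp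
        · rw [hX v hv, map_zero, mul_zero, sub_zero]
          exact Ideal.mul_mem_left _ _ (Ideal.subset_span ⟨v, hv, rfl⟩)
    have := key p
    rwa [(RingHom.mem_ker).mp hp, map_zero, sub_zero] at this
  · rw [Ideal.span_le]
    rintro _ ⟨v, hv, rfl⟩
    exact hX v hv

lemma killCompl_surjective {W : Type*} {f : W → V} (hf : Function.Injective f) :
    Function.Surjective (killCompl (R := K) hf) :=
  fun p => ⟨rename f p, killCompl_rename_app hf p⟩

variable (K) in
lemma ker_killCompl_coe_compl (s : Set V) :
    RingHom.ker (killCompl (R := K) (Subtype.val_injective (p := (· ∈ sᶜ)))) =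
      Ideal.span (X '' s) := by
  rw [ker_killCompl]
  congr 2
  ext v
  simp

variable (K) in
lemma isPrime_span_X_image (s : Set V) :
    (Ideal.span (X '' s) : Ideal (MvPolynomial V K)).IsPrime := by
  rw [← ker_killCompl_coe_compl K s]
  exact RingHom.ker_isPrime _

lemma X_mem_span_X_image {s : Set V} {v : V} :
    (X v : MvPolynomial V K) ∈ Ideal.span (X '' s) ↔ v ∈ s := by
  refine ⟨fun h => ?_, fun h => Ideal.subset_span ⟨v, h, rfl⟩⟩
  obtain ⟨w, hw, h⟩ := mem_ideal_span_X_image.mp h (Finsupp.single v 1) (by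
    rw [support_X]; simp)
  rw [Finsupp.single_apply_ne_zero] at h
  exact h.1 ▸ hw

lemma ringKrullDim_quotient_span_X_image [Finite V] (s : Set V) :
    ringKrullDim (MvPolynomial V K ⧸ (Ideal.span (X '' s) : Ideal (MvPolynomial V K))) =
      Nat.card (sᶜ : Set V) := by
  rw [← ker_killCompl_coe_compl K s, ringKrullDim_eq_of_ringEquiv
    (Ideal.quotientKerAlgEquivOfSurjective (killCompl_surjective _)).toRingEquiv,
    MvPolynomial.ringKrullDim_of_isNoetherianRing, ringKrullDim_eq_zero_of_field, zero_add]

lemma ofList_map_X (l : List V) :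
    Ideal.ofList (l.map (X (R := K))) = Ideal.span (X '' {v | v ∈ l}) := by
  rw [Ideal.ofList]
  congr 1
  ext p
  simp

lemma isWeaklyRegular_map_X {l : List V} (hl : l.Nodup) :
    IsWeaklyRegular (MvPolynomial V K) (l.map (X (R := K))) := by
  constructor
  intro i hi
  rw [isSMulRegular_quotient_iff_mem_of_smul_mem, ← List.map_take, ofList_map_X, List.getElem_map]
  simp only [smul_eq_mul, Ideal.mul_top]
  intro p hp
  refine ((isPrime_span_X_image K _).mem_or_mem hp).resolve_left ?_
  rw [X_mem_span_X_image, Set.mem_ofPred_eq, List.mem_take_iff_getElem]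
  rintro ⟨j, hj, h⟩
  have := (hl.getElem_inj_iff).mp h
  omega

/-- If the variables in `s` kill `T ≠ 0`, then they form a regular sequence which gives an embedding
of `Hom(R, T) = T` into `Ext^|s| (R ⧸ (s), T)`. -/
lemma not_subsingleton_ext_quotient_span_X_image (s : Finset V)
    (T : ModuleCat.{max u v} (MvPolynomial V K)) [Nontrivial T]
    (hT : ∀ v ∈ s, ∀ t : T, (X v : MvPolynomial V K) • t = 0) :
    ¬ Subsingleton (Ext (ModuleCat.of _
      (MvPolynomial V K ⧸ (Ideal.span (X '' s) : Ideal (MvPolynomial V K)))) T s.card) := by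
  intro h
  have h0 : Subsingleton (Ext (ModuleCat.of _ (MvPolynomial V K)) T 0) := by
    refine subsingleton_ext_of_quotient_ofList
      (isWeaklyRegular_map_X (K := K) s.nodup_toList) (fun r hr t => ?_) ?_
    · obtain ⟨v, hv, rfl⟩ := List.mem_map.mp hr
      exact hT v (Finset.mem_toList.mp hv) t
    rw [zero_add, List.length_map, Finset.length_toList]
    refine subsingleton_ext_of_linearEquiv
      (N := ModuleCat.of _ _) (N' := ModuleCat.of _ _) (Submodule.quotEquivOfEq _ _ ?_) h
    rw [ofList_map_X, smul_eq_mul, Ideal.mul_top]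
    simp
  obtain ⟨t, ht⟩ := exists_ne (0 : T)
  have h1 := Ext.homEquiv₀.symm.injective.subsingleton.elim
    (ModuleCat.ofHom (LinearMap.toSpanSingleton (MvPolynomial V K) T t)) 0
  have h2 := LinearMap.congr_fun (congrArg ModuleCat.Hom.hom h1) 1
  exact ht (by simpa using h2)

/-- The residue field at the origin has projective dimension at least the number of variables. -/
lemma not_hasProjectiveDimensionLT_quotient_idealOfVars [Finite V] :
    ¬ HasProjectiveDimensionLT
      (ModuleCat.of (MvPolynomial V K) (MvPolynomial V K ⧸ idealOfVars V K)) (Nat.card V) := by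
  have := Fintype.ofFinite V
  have hM : (Ideal.span (X '' ((Finset.univ : Finset V) : Set V)) : Ideal (MvPolynomial V K)) =
    idealOfVars V K := by simp
  have : Nontrivial (MvPolynomial V K ⧸ idealOfVars V K) := by
    rw [← hM]
    exact Ideal.Quotient.nontrivial_iff.mpr (isPrime_span_X_image K _).ne_top
  intro h
  have h0 := not_subsingleton_ext_quotient_span_X_image (K := K) (Finset.univ : Finset V)
    (ModuleCat.of (MvPolynomial V K) (MvPolynomial V K ⧸ idealOfVars V K)) (fun v _ t => by
      obtain ⟨p, rfl⟩ := Ideal.Quotient.mk_surjective t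
      exact (Submodule.Quotient.mk_eq_zero _).mpr
        (Ideal.mul_mem_right _ _ (Ideal.subset_span ⟨v, rfl⟩)))
  rw [hM, Finset.card_univ, ← Nat.card_eq_fintype_card] at h0
  exact h0 (h.subsingleton _ _ _ le_rfl _)

lemma ker_constantCoeff : RingHom.ker (constantCoeff (σ := V) (R := K)) = idealOfVars V K := by
  ext p
  rw [RingHom.mem_ker, ← pow_one (idealOfVars V K), mem_pow_idealOfVars_iff']
  simp [Finsupp.degree_eq_zero_iff, constantCoeff_eq]

lemma isMaximal_idealOfVars : (idealOfVars V K).IsMaximal := by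
  rw [← ker_constantCoeff]
  exact RingHom.ker_isMaximal_of_surjective _ (fun a => ⟨C a, constantCoeff_C _ a⟩)

/-- If no element of the maximal ideal `M` is regular on `N ≠ 0`, then `R ⧸ M` embeds in `N`, and
`pdim N = n` because `pdim (R ⧸ M) = n` is the largest possible value. -/
lemma exists_isSMulRegular_of_hasProjectiveDimensionLT [Finite V]
    (N : ModuleCat.{max u v} (MvPolynomial V K)) [Module.Finite (MvPolynomial V K) N]
    (h : HasProjectiveDimensionLT N (Nat.card V)) :
    ∃ r ∈ idealOfVars V K, IsSMulRegular N r := by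
  let k := MvPolynomial V K ⧸ idealOfVars V K
  have hk : Module.annihilator (MvPolynomial V K) k = idealOfVars V K := Ideal.annihilator_quotient
  by_contra hr
  have hN : ¬ Subsingleton (k →ₗ[MvPolynomial V K] N) := fun hN =>
    hr (hk ▸ IsSMulRegular.subsingleton_linearMap_iff.mp hN)
  obtain ⟨f, hf⟩ := not_forall.mp fun h0 => hN (subsingleton_of_forall_eq 0 h0)
  have : IsSimpleModule (MvPolynomial V K) k :=
    (isSimpleModule_iff_isCoatom).mpr (isMaximal_idealOfVars).out
  have hinj : Function.Injective f := f.injective_or_eq_zero.resolve_right hf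
  let S : ShortComplex (ModuleCat.{max u v} (MvPolynomial V K)) :=
    ModuleCat.shortComplexOfCompEqZero f f.range.mkQ f.exact_map_mkQ_range.linearMap_comp_eq_zero
  have hS : S.ShortExact := ModuleCat.shortComplex_shortExact S f.exact_map_mkQ_range hinj
    (Submodule.mkQ_surjective _)
  exact not_hasProjectiveDimensionLT_quotient_idealOfVars (K := K) (V := V)
    (hS.hasProjectiveDimensionLT_X₁ _ h (hasProjectiveDimensionLE_mvPolynomial V K _))

/-- One half of the Auslander–Buchsbaum formula: `n - pdim N ≤ depth N`. -/
theorem exists_isWeaklyRegular_of_hasProjectiveDimensionLE [Finite V]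
    (N : ModuleCat.{max u v} (MvPolynomial V K)) [Module.Finite (MvPolynomial V K) N] {q d : ℕ}
    (hqd : q + d = Nat.card V) (h : HasProjectiveDimensionLE N q) :
    ∃ rs : List (MvPolynomial V K), rs.length = d ∧ (∀ r ∈ rs, r ∈ idealOfVars V K) ∧
      IsWeaklyRegular N rs := by
  induction d generalizing q N with
  | zero => exact ⟨[], rfl, by simp, .nil _ _⟩
  | succ d ih =>
    obtain ⟨r, hrM, hr⟩ := exists_isSMulRegular_of_hasProjectiveDimensionLT N
      (hasProjectiveDimensionLT_of_ge N (q + 1) _ (by omega))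
    obtain ⟨rs, hlen, hM, hrs⟩ := ih (ModuleCat.of _ (QuotSMulTop r N)) (q := q + 1) (by omega)
      (hr.smulShortComplex_shortExact.hasProjectiveDimensionLT_X₃ (q + 1) h
        (hasProjectiveDimensionLT_of_ge N (q + 1) _ (by omega)))
    exact ⟨r :: rs, by simp [hlen], by simpa [hrM] using hM, .cons hr hrs⟩

end Variables

/-! ### Graded modules over a polynomial ring -/

section Graded

open MvPolynomial

variable {V : Type u} {K : Type v} [Field K]

lemma mem_idealOfVars_smul_induction {N : Type w} [AddCommGroup N] [Module (MvPolynomial V K) N]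
    {p : N → Prop} (zero : p 0)
    (add : ∀ m n, p m → p n → p (m + n)) (X_smul : ∀ v n, p ((X v : MvPolynomial V K) • n))
    {n : N} (hn : n ∈ (idealOfVars V K • ⊤ : Submodule (MvPolynomial V K) N)) : p n := by
  induction hn using Submodule.smul_induction_on' with
  | smul r hr n _ =>
    induction hr using Submodule.span_induction generalizing n with
    | mem r hr => obtain ⟨v, rfl⟩ := hr; exact X_smul v n
    | zero => rwa [zero_smul]
    | add r s _ _ hr hs => rw [add_smul]; exact add _ _ (hr n trivial) (hs n trivial)
    | smul a r _ hr => rw [smul_eq_mul, mul_comm, mul_smul]; exact hr _ trivial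
  | add m _ n _ hm hn => exact add _ _ hm hn

/-- An `ℕ`-grading of a module over the polynomial ring, given by the projections
`comp i : N → N` onto the homogeneous components, where the variables have degree one. The last
field says that every element is the sum of its finitely many nonzero components. -/
structure NatGrading (V : Type u) (K : Type v) [Field K] (N : Type w) [AddCommGroup N]
    [Module (MvPolynomial V K) N] [Module K N] where
  comp : ℕ → N →ₗ[K] N
  comp_comp_self : ∀ i n, comp i (comp i n) = comp i n
  comp_comp_of_ne : ∀ i j n, i ≠ j → comp i (comp j n) = 0
  comp_zero_X_smul : ∀ v n, comp 0 ((X v : MvPolynomial V K) • n) = 0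
  comp_succ_X_smul : ∀ i v n, comp (i + 1) ((X v : MvPolynomial V K) • n) =
    (X v : MvPolynomial V K) • comp i n
  eventually_sum_comp : ∀ n, ∀ᶠ k in Filter.atTop, ∑ i ∈ Finset.range k, comp i n = n

namespace NatGrading

variable {N : Type w} [AddCommGroup N] [Module (MvPolynomial V K) N] [Module K N]
  (𝒩 : NatGrading V K N)

lemma mem_of_comp_mem {S : Type*} [SetLike S N] [AddSubmonoidClass S N] {s : S} {n : N}
    (h : ∀ i, 𝒩.comp i n ∈ s) : n ∈ s := by
  obtain ⟨k, hk⟩ := (𝒩.eventually_sum_comp n).exists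
  rw [← hk]
  exact sum_mem fun i _ => h i

/-- The homogeneous elements of a graded module. -/
def IsHomogeneousElement (n : N) : Prop := ∃ d, 𝒩.comp d n = n

/-- **Graded Nakayama lemma**: homogeneous elements that generate `N` modulo `M N` generate `N`.
No finiteness is needed since the grading is bounded below. -/
lemma span_range_eq_top {ι : Type*} {f : ι → N} (hf : ∀ b, 𝒩.IsHomogeneousElement (f b))
    [IsScalarTower K (MvPolynomial V K) N]
    (h : ∀ n, ∃ c ∈ Submodule.span K (Set.range f),
      n - c ∈ (idealOfVars V K • ⊤ : Submodule (MvPolynomial V K) N)) :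
    Submodule.span (MvPolynomial V K) (Set.range f) = ⊤ := by
  set L := Submodule.span (MvPolynomial V K) (Set.range f)
  have hspan {c : N} (hc : c ∈ Submodule.span K (Set.range f)) (i : ℕ) : 𝒩.comp i c ∈ L := by
    induction hc using Submodule.span_induction with
    | mem c hc =>
      obtain ⟨b, rfl⟩ := hc
      obtain ⟨d, hd⟩ := hf b
      rw [← hd]
      by_cases hid : i = d
      · rw [hid, 𝒩.comp_comp_self, hd]
        exact Submodule.subset_span ⟨b, rfl⟩
      · rw [𝒩.comp_comp_of_ne _ _ _ hid]
        exact zero_mem _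
    | zero => simp
    | add c d _ _ hc hd => rw [map_add]; exact add_mem hc hd
    | smul a c _ hc =>
      rw [map_smul, ← algebraMap_smul (MvPolynomial V K)]
      exact L.smul_mem _ hc
  have key (i : ℕ) (n : N) : 𝒩.comp i n ∈ L := by
    induction i generalizing n with
    | zero =>
      obtain ⟨c, hc, hn⟩ := h n
      have h0 : 𝒩.comp 0 (n - c) ∈ L :=
        mem_idealOfVars_smul_induction (p := fun n => 𝒩.comp 0 n ∈ L) (by simp)
          (fun m n hm hn => by rw [map_add]; exact add_mem hm hn)
          (fun v n => by rw [𝒩.comp_zero_X_smul]; exact zero_mem _) hn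
      rw [map_sub] at h0
      exact (L.sub_mem_iff_left (hspan hc 0)).mp h0
    | succ i ih =>
      obtain ⟨c, hc, hn⟩ := h n
      have h0 : 𝒩.comp (i + 1) (n - c) ∈ L :=
        mem_idealOfVars_smul_induction (p := fun n => 𝒩.comp (i + 1) n ∈ L) (by simp)
          (fun m n hm hn => by rw [map_add]; exact add_mem hm hn)
          (fun v n => by rw [𝒩.comp_succ_X_smul]; exact L.smul_mem _ (ih n)) hn
      rw [map_sub] at h0
      exact (L.sub_mem_iff_left (hspan hc _)).mp h0
  exact eq_top_iff.mpr fun n _ => 𝒩.mem_of_comp_mem fun i => key i n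

/-- A grading induces one on each homogeneous submodule. -/
noncomputable def submodule [IsScalarTower K (MvPolynomial V K) N]
    (L : Submodule (MvPolynomial V K) N)
    (hL : ∀ i, ∀ n ∈ L, 𝒩.comp i n ∈ L) : NatGrading V K L where
  comp i := (𝒩.comp i).restrict (p := L.restrictScalars K) (q := L.restrictScalars K) (hL i)
  comp_comp_self i n := Subtype.ext (𝒩.comp_comp_self i n)
  comp_comp_of_ne i j n h := Subtype.ext (𝒩.comp_comp_of_ne i j n h)
  comp_zero_X_smul v n := Subtype.ext (𝒩.comp_zero_X_smul v n)
  comp_succ_X_smul i v n := Subtype.ext (𝒩.comp_succ_X_smul i v n)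
  eventually_sum_comp n := by
    filter_upwards [𝒩.eventually_sum_comp n] with k hk
    apply Subtype.ext
    rw [AddSubmonoidClass.coe_finsetSum]
    exact hk

/-- A grading induces one on the quotient by each homogeneous submodule. -/
noncomputable def quotient [IsScalarTower K (MvPolynomial V K) N]
    (L : Submodule (MvPolynomial V K) N)
    (hL : ∀ i, ∀ n ∈ L, 𝒩.comp i n ∈ L) : NatGrading V K (N ⧸ L) where
  comp i := (Submodule.Quotient.restrictScalarsEquiv K L).toLinearMap ∘ₗ
    (L.restrictScalars K).mapQ (L.restrictScalars K) (𝒩.comp i) (hL i) ∘ₗ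
    (Submodule.Quotient.restrictScalarsEquiv K L).symm.toLinearMap
  comp_comp_self i n := by
    obtain ⟨n, rfl⟩ := L.mkQ_surjective n
    exact congrArg L.mkQ (𝒩.comp_comp_self i n)
  comp_comp_of_ne i j n h := by
    obtain ⟨n, rfl⟩ := L.mkQ_surjective n
    exact congrArg L.mkQ (𝒩.comp_comp_of_ne i j n h)
  comp_zero_X_smul v n := by
    obtain ⟨n, rfl⟩ := L.mkQ_surjective n
    exact congrArg L.mkQ (𝒩.comp_zero_X_smul v n)
  comp_succ_X_smul i v n := by
    obtain ⟨n, rfl⟩ := L.mkQ_surjective n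
    exact congrArg L.mkQ (𝒩.comp_succ_X_smul i v n)
  eventually_sum_comp n := by
    obtain ⟨n, rfl⟩ := L.mkQ_surjective n
    filter_upwards [𝒩.eventually_sum_comp n] with k hk
    refine Eq.trans ?_ (congrArg L.mkQ hk)
    rw [map_sum]
    rfl

/-- The grading shifted up by `d`. -/
noncomputable def shift (d : ℕ) : NatGrading V K N where
  comp i := if d ≤ i then 𝒩.comp (i - d) else 0
  comp_comp_self i n := by
    split_ifs with h
    · exact 𝒩.comp_comp_self _ n
    · rfl
  comp_comp_of_ne i j n h := by
    split_ifs with h₁ h₂ h₂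
    · exact 𝒩.comp_comp_of_ne _ _ n (by omega)
    · exact map_zero _
    · rfl
    · rfl
  comp_zero_X_smul v n := by
    split_ifs with h
    · rw [Nat.zero_sub]
      exact 𝒩.comp_zero_X_smul v n
    · rfl
  comp_succ_X_smul i v n := by
    by_cases h : d ≤ i
    · rw [if_pos h, if_pos (by omega), Nat.sub_add_comm h]
      exact 𝒩.comp_succ_X_smul _ v n
    · rw [if_neg h, LinearMap.zero_apply, smul_zero]
      split_ifs with h'
      · rw [show i + 1 - d = 0 by omega]
        exact 𝒩.comp_zero_X_smul v n
      · rfl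
  eventually_sum_comp n := by
    filter_upwards [(Filter.tendsto_sub_atTop_nat d).eventually (𝒩.eventually_sum_comp n),
      Filter.eventually_ge_atTop d] with k hk hdk
    obtain ⟨k, rfl⟩ := Nat.exists_eq_add_of_le hdk
    rw [Nat.add_sub_cancel_left] at hk
    rw [Finset.sum_range_add, Finset.sum_eq_zero, zero_add]
    · simpa using hk
    · intro i hi
      rw [if_neg (by simpa using hi), LinearMap.zero_apply]

/-- The direct sum of gradings. -/
noncomputable def finsupp {ι : Type*} (𝒩 : ι → NatGrading V K N) : NatGrading V K (ι →₀ N) where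
  comp i := Finsupp.lsum K fun b => (Finsupp.lsingle b).comp ((𝒩 b).comp i)
  comp_comp_self i n := by
    induction n using Finsupp.induction_linear with
    | zero => simp
    | add m n hm hn => simp only [map_add, hm, hn]
    | single b n => simp [(𝒩 b).comp_comp_self]
  comp_comp_of_ne i j n h := by
    induction n using Finsupp.induction_linear with
    | zero => simp
    | add m n hm hn => simp only [map_add, hm, hn, add_zero]
    | single b n => simp [(𝒩 b).comp_comp_of_ne i j n h]
  comp_zero_X_smul v n := by
    induction n using Finsupp.induction_linear with
    | zero => simp
    | add m n hm hn => simp only [smul_add, map_add, hm, hn, add_zero]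
    | single b n => simp [(𝒩 b).comp_zero_X_smul]
  comp_succ_X_smul i v n := by
    induction n using Finsupp.induction_linear with
    | zero => simp
    | add m n hm hn => simp only [smul_add, map_add, hm, hn]
    | single b n => simp [(𝒩 b).comp_succ_X_smul]
  eventually_sum_comp n := by
    induction n using Finsupp.induction_linear with
    | zero => simp
    | add m n hm hn =>
      filter_upwards [hm, hn] with k hm hn
      simp only [map_add, Finset.sum_add_distrib, hm, hn]
    | single b n =>
      filter_upwards [(𝒩 b).eventually_sum_comp n] with k hk
      simp [← Finsupp.single_finsetSum, hk]

variable (V K) in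
/-- The standard grading of the polynomial ring. -/
noncomputable def self : NatGrading V K (MvPolynomial V K) where
  comp i := homogeneousComponent i
  comp_comp_self i p := by
    rw [homogeneousComponent_of_mem (homogeneousComponent_mem i p), if_pos rfl]
  comp_comp_of_ne i j p h := by
    rw [homogeneousComponent_of_mem (homogeneousComponent_mem j p), if_neg h]
  comp_zero_X_smul v p := by
    classical
    simp [homogeneousComponent_zero, coeff_X_mul']
  comp_succ_X_smul i v p := by
    classical
    ext m
    rw [smul_eq_mul, smul_eq_mul, coeff_homogeneousComponent, coeff_X_mul', coeff_X_mul',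
      coeff_homogeneousComponent]
    by_cases hv : v ∈ m.support
    · have hm : (m - Finsupp.single v 1).degree + 1 = m.degree := by
        conv_rhs => rw [← Finsupp.sub_add_single_one_cancel (Finsupp.mem_support_iff.mp hv)]
        simp
      simp only [if_pos hv, ← hm, add_left_inj]
    · simp [hv]
  eventually_sum_comp p := by
    filter_upwards [Filter.eventually_ge_atTop (p.totalDegree + 1)] with k hk
    rw [← Finset.sum_subset (Finset.range_mono hk), sum_homogeneousComponent]
    intro i _ hi
    exact homogeneousComponent_eq_zero _ _ (by simpa using hi)

/-- The grading of the free module with basis elements of prescribed degrees. -/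
noncomputable def free {ι : Type*} (d : ι → ℕ) : NatGrading V K (ι →₀ MvPolynomial V K) :=
  finsupp fun b => (self V K).shift (d b)

lemma comp_smul_of_comp_eq_self [IsScalarTower K (MvPolynomial V K) N] {d : ℕ} {n : N}
    (hn : 𝒩.comp d n = n) (i : ℕ) (p : MvPolynomial V K) :
    𝒩.comp i (p • n) = ((self V K).shift d).comp i p • n := by
  induction p using MvPolynomial.induction_on generalizing i with
  | C a =>
    have hC (j : ℕ) : (self V K).comp j (C a) = if j = 0 then C a else 0 :=
      homogeneousComponent_of_mem (isHomogeneous_C V a)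
    have hCn : (C a : MvPolynomial V K) • n = a • n := algebraMap_smul (MvPolynomial V K) a n
    rw [hCn, map_smul]
    by_cases hid : i = d
    · subst hid
      simp [shift, hC, hn, hCn]
    · rw [← hn, 𝒩.comp_comp_of_ne i d n hid]
      simp only [shift]
      split_ifs with h
      · rw [hC, if_neg (by omega), zero_smul, smul_zero]
      · simp
  | add p q hp hq => rw [add_smul, map_add, map_add, add_smul, hp, hq]
  | mul_X p v hp =>
    rw [mul_comm, mul_smul, ← smul_eq_mul (X v) p]
    cases i with
    | zero => rw [comp_zero_X_smul, comp_zero_X_smul, zero_smul]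
    | succ i => rw [comp_succ_X_smul, comp_succ_X_smul, hp, smul_assoc]

open Finsupp in
/-- Every graded module `N` has a minimal graded free cover `F → N`: its kernel is a graded
submodule of `M F`. The basis of `F` maps to homogeneous elements that form a basis of `N ⧸ M N` over `K`. -/
theorem exists_minimal_cover [IsScalarTower K (MvPolynomial V K) N] (𝒩 : NatGrading V K N) :
    ∃ (ι : Type w) (π : (ι →₀ MvPolynomial V K) →ₗ[MvPolynomial V K] N), Function.Surjective π ∧
      LinearMap.ker π ≤ idealOfVars V K • ⊤ ∧ Nonempty (NatGrading V K (LinearMap.ker π)) := by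
  set L : Submodule (MvPolynomial V K) N := idealOfVars V K • ⊤
  obtain ⟨b, hbs, hspan, hli⟩ :=
    exists_linearIndependent K (L.mkQ '' {n | 𝒩.IsHomogeneousElement n})
  choose f hf hfb using fun x : b => hbs x.2
  choose d hd using hf
  let π : (b →₀ MvPolynomial V K) →ₗ[MvPolynomial V K] N :=
    Finsupp.linearCombination (MvPolynomial V K) f
  let q : N →ₗ[K] N ⧸ L := L.mkQ.restrictScalars K
  have hq (p : MvPolynomial V K) (n : N) : L.mkQ (p • n) = constantCoeff p • L.mkQ n := by
    have hp : p - C (constantCoeff p) ∈ idealOfVars V K := by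
      rw [← ker_constantCoeff, RingHom.mem_ker, map_sub, constantCoeff_C, sub_self]
    have h0 : L.mkQ ((p - C (constantCoeff p)) • n) = 0 :=
      (Submodule.Quotient.mk_eq_zero L).mpr (Submodule.smul_mem_smul hp trivial)
    rw [sub_smul, map_sub, sub_eq_zero] at h0
    rw [h0, map_smul]
    exact algebraMap_smul (MvPolynomial V K) _ _
  have hπq (z : b →₀ MvPolynomial V K) : L.mkQ (π z) = Finsupp.linearCombination K
      (fun x : b => (x : N ⧸ L)) (z.mapRange constantCoeff (map_zero _)) := by
    induction z using Finsupp.induction_linear with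
    | zero => simp
    | add y z hy hz => rw [map_add, map_add, hy, hz, mapRange_add (map_add _), map_add]
    | single x p =>
      rw [mapRange_single, linearCombination_single, linearCombination_single, hq, hfb]
  have hcomp (i : ℕ) (z : b →₀ MvPolynomial V K) : π ((free d).comp i z) = 𝒩.comp i (π z) := by
    induction z using Finsupp.induction_linear with
    | zero => simp
    | add y z hy hz => simp only [map_add, hy, hz]
    | single x p =>
      rw [linearCombination_single, 𝒩.comp_smul_of_comp_eq_self (hd x)]
      simp [free, finsupp, π]
  refine ⟨b, π, ?_, fun z hz => ?_, ⟨(free d).submodule _ fun i z hz => ?_⟩⟩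
  · rw [← LinearMap.range_eq_top, Finsupp.range_linearCombination]
    refine 𝒩.span_range_eq_top (fun x => ⟨d x, hd x⟩) fun n => ?_
    have hn : q n ∈ (Submodule.span K (Set.range f)).map q := by
      rw [Submodule.map_span, ← Set.range_comp]
      have hqf : q ∘ f = Subtype.val := funext hfb
      rw [hqf, Subtype.range_coe, hspan]
      refine 𝒩.mem_of_comp_mem (s := (Submodule.span K (L.mkQ ''
        {n | 𝒩.IsHomogeneousElement n})).comap q) fun i => Submodule.subset_span ?_
      exact ⟨_, ⟨i, 𝒩.comp_comp_self i n⟩, rfl⟩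
    obtain ⟨c, hc, hcn⟩ := hn
    exact ⟨c, hc, (Submodule.Quotient.eq L).mp hcn.symm⟩
  · have h0 := hπq z
    rw [LinearMap.mem_ker.mp hz, map_zero] at h0
    have h1 := linearIndependent_iff.mp hli _ h0.symm
    rw [← z.sum_single]
    refine Submodule.sum_mem _ fun x _ => ?_
    rw [← mul_one (z x), ← smul_eq_mul, ← Finsupp.smul_single]
    refine Submodule.smul_mem_smul ?_ trivial
    rw [← ker_constantCoeff, RingHom.mem_ker]
    exact DFunLike.congr_fun h1 x
  · rw [LinearMap.mem_ker, hcomp, LinearMap.mem_ker.mp hz, map_zero]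

end NatGrading

/-- The projective dimension of a graded module is detected by `Ext` into modules killed by the
variables. -/
theorem hasProjectiveDimensionLT_of_subsingleton_ext (q : ℕ) {N : Type (max u v)} [AddCommGroup N]
    [Module (MvPolynomial V K) N] [Module K N] [IsScalarTower K (MvPolynomial V K) N]
    (𝒩 : NatGrading V K N)
    (h : ∀ T : ModuleCat.{max u v} (MvPolynomial V K),
      (∀ v, ∀ t : T, (X v : MvPolynomial V K) • t = 0) →
        Subsingleton (Ext (ModuleCat.of (MvPolynomial V K) N) T q)) :
    HasProjectiveDimensionLT (ModuleCat.of (MvPolynomial V K) N) q := by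
  induction q generalizing N with
  | zero =>
    let L : Submodule (MvPolynomial V K) N := idealOfVars V K • ⊤
    have hT : ∀ v, ∀ t : N ⧸ L, (X v : MvPolynomial V K) • t = 0 := by
      intro v t
      obtain ⟨n, rfl⟩ := L.mkQ_surjective t
      exact (Submodule.Quotient.mk_eq_zero L).mpr
        (Submodule.smul_mem_smul (Ideal.subset_span ⟨v, rfl⟩) trivial)
    have h0 := h (ModuleCat.of _ (N ⧸ L)) hT
    have h1 := Ext.homEquiv₀.symm.injective.subsingleton.elim (ModuleCat.ofHom L.mkQ) 0
    have h2 := 𝒩.span_range_eq_top (f := PEmpty.elim.{_, 1}) (fun b => b.elim) fun n =>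
      ⟨0, zero_mem _, by
        rw [sub_zero]
        exact (Submodule.Quotient.mk_eq_zero L).mp
          (LinearMap.congr_fun (congrArg ModuleCat.Hom.hom h1) n)⟩
    rw [Set.range_eq_empty, Submodule.span_empty] at h2
    have : Subsingleton N := (Submodule.subsingleton_iff _).mp (subsingleton_of_bot_eq_top h2)
    exact (ModuleCat.isZero_of_subsingleton _).hasProjectiveDimensionLT_zero
  | succ q ih =>
    obtain ⟨ι, π, hπ, hker, ⟨𝒵⟩⟩ := 𝒩.exists_minimal_cover
    have hS : π.shortComplexKer.ShortExact := LinearMap.shortExact_shortComplexKer hπ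
    have : Projective π.shortComplexKer.X₂ := by
      rw [← IsProjective.iff_projective]
      exact inferInstanceAs (Module.Projective (MvPolynomial V K) (ι →₀ MvPolynomial V K))
    refine hS.hasProjectiveDimensionLT_X₃ q (ih 𝒵 fun T hT => ?_)
      (hasProjectiveDimensionLT_of_ge _ 1 _ (by omega))
    refine subsingleton_of_forall_eq 0 fun x => ?_
    obtain ⟨y, rfl⟩ := Ext.contravariant_sequence_exact₁ hS T x (add_comm 1 q) ((h T hT).elim _ _)
    cases q with
    | zero =>
      obtain ⟨φ, rfl⟩ := Ext.homEquiv₀.symm.surjective y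
      -- Maps from `F` to `T` vanish on `M F`, which contains the kernel by minimality.
      have hφ : π.shortComplexKer.f ≫ φ = 0 := by
        ext z
        exact mem_idealOfVars_smul_induction (p := fun z => φ.hom z = 0) (map_zero _)
          (fun m n hm hn => by rw [map_add, hm, hn, add_zero])
          (fun v n => by rw [map_smul, hT]) (hker z.2)
      simp [hφ]
    | succ q => rw [Ext.eq_zero_of_projective y, Ext.comp_zero]

/-- The other half of the Auslander–Buchsbaum formula, `pdim N ≤ n - depth N`, for graded `N`. -/
theorem hasProjectiveDimensionLT_of_isWeaklyRegular [Finite V] {N : Type (max u v)}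
    [AddCommGroup N] [Module (MvPolynomial V K) N] [Module K N]
    [IsScalarTower K (MvPolynomial V K) N] (𝒩 : NatGrading V K N) {rs : List (MvPolynomial V K)}
    (hM : ∀ r ∈ rs, r ∈ idealOfVars V K) (hrs : IsWeaklyRegular N rs) {q : ℕ}
    (hq : Nat.card V < q + rs.length) :
    HasProjectiveDimensionLT (ModuleCat.of (MvPolynomial V K) N) q := by
  refine hasProjectiveDimensionLT_of_subsingleton_ext q 𝒩 fun T hT => ?_
  refine subsingleton_ext_of_quotient_ofList (N := ModuleCat.of _ N) hrs (fun r hr t => ?_)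
    ((hasProjectiveDimensionLE_mvPolynomial V K _).subsingleton _ _ _ hq T)
  have hM' : idealOfVars V K ≤
      LinearMap.ker (LinearMap.toSpanSingleton (MvPolynomial V K) T t) := by
    rw [Ideal.span_le]
    rintro _ ⟨v, rfl⟩
    exact hT v t
  exact hM' (hM r hr)

end Graded

/-! ### Stanley–Reisner rings -/

namespace Complex

open MvPolynomial

variable {V : Type u} (Δ : Complex V) (K : Type v) [Field K]

lemma exists_facet_ge [Finite V] {A : Finset V} (hA : A ∈ Δ.faces) :
    ∃ F, Δ.IsFacet F ∧ A ⊆ F := by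
  obtain ⟨F, hAF, hF⟩ := (Set.toFinite Δ.faces).exists_le_maximal hA
  exact ⟨F, hF, hAF⟩

lemma prod_X_mem_stanleyReisnerIdeal {A : Finset V} (hA : A ∉ Δ.faces) :
    ∏ x ∈ A, (X x : MvPolynomial V K) ∈ Δ.stanleyReisnerIdeal K := by
  obtain ⟨B, hBA, hB⟩ := exists_minimal_le_of_wellFoundedLT (fun F => F ∉ Δ.faces) A hA
  exact Ideal.mem_of_dvd _ (Finset.prod_dvd_prod_of_subset _ _ _ hBA)
    (Ideal.subset_span ⟨B, hB, rfl⟩)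

lemma stanleyReisnerIdeal_le {F : Finset V} (hF : F ∈ Δ.faces) :
    Δ.stanleyReisnerIdeal K ≤ Ideal.span (X '' (F : Set V)ᶜ) := by
  rw [stanleyReisnerIdeal, Ideal.span_le]
  rintro _ ⟨A, hA, rfl⟩
  obtain ⟨x, hxA, hxF⟩ := Finset.not_subset.mp fun h => hA.prop (Δ.down_closed hF h)
  exact Ideal.mem_of_dvd _ (Finset.dvd_prod_of_mem _ hxA) (Ideal.subset_span ⟨x, hxF, rfl⟩)

/-- The Stanley–Reisner ideal is the intersection of the prime ideals attached to the facets. -/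
lemma exists_facet_notMem_of_notMem [Finite V] {p : MvPolynomial V K}
    (hp : p ∉ Δ.stanleyReisnerIdeal K) :
    ∃ F, Δ.IsFacet F ∧ p ∉ Ideal.span (X '' (F : Set V)ᶜ) := by
  obtain ⟨m, hm, hmΔ⟩ : ∃ m ∈ p.support, m.support ∈ Δ.faces := by
    by_contra! h
    refine hp ?_
    rw [p.as_sum]
    refine Ideal.sum_mem _ fun m hm => ?_
    refine Ideal.mem_of_dvd _ ?_ (Δ.prod_X_mem_stanleyReisnerIdeal K (h m hm))
    rw [monomial_eq]
    exact Dvd.dvd.mul_left (Finset.prod_dvd_prod_of_dvd _ _ fun x hx =>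
      dvd_pow_self _ (Finsupp.mem_support_iff.mp hx)) _
  obtain ⟨F, hF, hmF⟩ := Δ.exists_facet_ge hmΔ
  refine ⟨F, hF, fun h => ?_⟩
  obtain ⟨x, hxF, hx⟩ := mem_ideal_span_X_image.mp h m hm
  exact hxF (hmF (Finsupp.mem_support_iff.mpr hx))

lemma X_mul_prod_mem_of_isFacet {F : Finset V} (hF : Δ.IsFacet F) {x : V} (hx : x ∉ F) :
    X x * ∏ y ∈ F, (X y : MvPolynomial V K) ∈ Δ.stanleyReisnerIdeal K := by
  classical
  rw [← Finset.prod_insert hx]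
  exact Δ.prod_X_mem_stanleyReisnerIdeal K fun h =>
    hx (hF.le_of_ge h (Finset.subset_insert x F) (Finset.mem_insert_self x F))

/-- The annihilator in `K[Δ]` of the product of the variables of a facet `F` is generated by the
variables outside `F`. -/
lemma mul_prod_mem_iff_of_isFacet {F : Finset V} (hF : Δ.IsFacet F) (p : MvPolynomial V K) :
    p * ∏ y ∈ F, (X y : MvPolynomial V K) ∈ Δ.stanleyReisnerIdeal K ↔
      p ∈ Ideal.span (X '' (F : Set V)ᶜ) := by
  constructor
  · intro h
    have hP := isPrime_span_X_image K (F : Set V)ᶜ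
    refine (hP.mem_or_mem (Δ.stanleyReisnerIdeal_le K hF.prop h)).resolve_right fun h => ?_
    obtain ⟨x, hx, h⟩ := hP.prod_mem_iff.mp h
    exact X_mem_span_X_image.mp h hx
  · intro h
    induction h using Submodule.span_induction with
    | mem p hp => obtain ⟨x, hx, rfl⟩ := hp; exact Δ.X_mul_prod_mem_of_isFacet K hF hx
    | zero => rw [zero_mul]; exact zero_mem _
    | add p q _ _ hp hq => rw [add_mul]; exact add_mem hp hq
    | smul a p _ hp => rw [smul_eq_mul, mul_assoc]; exact Ideal.mul_mem_left _ _ hp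

lemma mem_associatedPrimes_of_isFacet [Finite V] {F : Finset V} (hF : Δ.IsFacet F) :
    Ideal.span (X '' (F : Set V)ᶜ) ∈
      associatedPrimes (MvPolynomial V K) (Δ.StanleyReisnerRing K) := by
  rw [AssociatedPrimes.mem_iff, isAssociatedPrime_iff]
  refine ⟨isPrime_span_X_image K _, Ideal.Quotient.mk _ (∏ y ∈ F, X y), ?_⟩
  ext p
  rw [Submodule.mem_colon_singleton, Submodule.mem_bot, ← Δ.mul_prod_mem_iff_of_isFacet K hF,
    ← Ideal.Quotient.eq_zero_iff_mem]
  rfl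

/-- The annihilator of `p` lies in the prime ideal of each facet whose prime ideal omits `p`. -/
lemma exists_facet_le_of_mem_associatedPrimes [Finite V] {P : Ideal (MvPolynomial V K)}
    (hP : P ∈ associatedPrimes (MvPolynomial V K) (Δ.StanleyReisnerRing K)) :
    ∃ F, Δ.IsFacet F ∧ P ≤ Ideal.span (X '' (F : Set V)ᶜ) := by
  rw [AssociatedPrimes.mem_iff, isAssociatedPrime_iff] at hP
  obtain ⟨hP, n, rfl⟩ := hP
  obtain ⟨p, rfl⟩ := Ideal.Quotient.mk_surjective n
  have hmem (a : MvPolynomial V K) : a ∈ Submodule.colon (⊥ : Submodule (MvPolynomial V K)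
      (Δ.StanleyReisnerRing K)) {Ideal.Quotient.mk _ p} ↔ a * p ∈ Δ.stanleyReisnerIdeal K := by
    rw [Submodule.mem_colon_singleton, Submodule.mem_bot, ← Ideal.Quotient.eq_zero_iff_mem]
    rfl
  have hp : p ∉ Δ.stanleyReisnerIdeal K := fun h =>
    hP.ne_top (Ideal.eq_top_iff_one _ |>.mpr ((hmem 1).mpr (by rwa [one_mul])))
  obtain ⟨F, hF, hpF⟩ := Δ.exists_facet_notMem_of_notMem K hp
  exact ⟨F, hF, fun a ha => ((isPrime_span_X_image K _).mem_or_mem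
    (Δ.stanleyReisnerIdeal_le K hF.prop ((hmem a).mp ha))).resolve_right hpF⟩

lemma ringKrullDim_quotient_of_finset [Finite V] (F : Finset V) :
    ringKrullDim (MvPolynomial V K ⧸ (Ideal.span (X '' (F : Set V)ᶜ) : Ideal (MvPolynomial V K))) =
      F.card := by
  rw [ringKrullDim_quotient_span_X_image, compl_compl]
  simp

/-- The initial dimension of `K[Δ]` is the cardinality of a minimum facet. -/
theorem indim_stanleyReisnerRing [Finite V] {F : Finset V} (hF : Δ.IsMinimumFacet F) :
    indim (MvPolynomial V K) (Δ.StanleyReisnerRing K) = F.card := by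
  apply le_antisymm
  · rw [← ringKrullDim_quotient_of_finset K F]
    exact iInf₂_le _ (Δ.mem_associatedPrimes_of_isFacet K hF.1)
  · refine le_iInf₂ fun P hP => ?_
    obtain ⟨F', hF', hPF'⟩ := Δ.exists_facet_le_of_mem_associatedPrimes K hP
    refine le_trans ?_ (ringKrullDim_le_of_surjective _ (Ideal.Quotient.factor_surjective hPF'))
    rw [ringKrullDim_quotient_of_finset]
    exact_mod_cast hF.2 F' hF'

/-- The Stanley–Reisner ring inherits the standard grading of the polynomial ring. -/
noncomputable def gradingStanleyReisnerRing : NatGrading V K (Δ.StanleyReisnerRing K) :=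
  (NatGrading.self V K).quotient (Δ.stanleyReisnerIdeal K) fun i p hp => by
    suffices ∀ a : MvPolynomial V K, (NatGrading.self V K).comp i (a • p) ∈
        Δ.stanleyReisnerIdeal K by simpa using this 1
    induction hp using Submodule.span_induction with
    | mem p hp =>
      obtain ⟨A, hA, rfl⟩ := hp
      have h : (∏ x ∈ A, (X x : MvPolynomial V K)).IsHomogeneous A.card := by
        simpa using IsHomogeneous.prod A _ (fun _ => 1) fun x _ => isHomogeneous_X K x
      intro a
      rw [NatGrading.comp_smul_of_comp_eq_self _ (d := A.card)
        ((homogeneousComponent_of_mem h).trans (if_pos rfl))]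
      exact Ideal.mul_mem_left _ _ (Ideal.subset_span ⟨A, hA, rfl⟩)
    | zero => simp
    | add p q _ _ hp hq => intro a; rw [smul_add, map_add]; exact add_mem (hp a) (hq a)
    | smul b p _ hp => intro a; rw [smul_smul]; exact hp _

/-- The projective dimension of `K[Δ]` is at least the height of each of its associated primes.
At the point where the variables in the facet `F` are one and the others zero, `K[Δ]` is locally
isomorphic to the polynomial ring modulo the variables outside `F`. -/
theorem not_hasProjectiveDimensionLT_of_isFacet [Fintype V] [DecidableEq V] {F : Finset V}
    (hF : Δ.IsFacet F) :
    ¬ HasProjectiveDimensionLT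
      (ModuleCat.of (MvPolynomial V K) (Δ.StanleyReisnerRing K)) Fᶜ.card := by
  intro h
  let P : Ideal (MvPolynomial V K) := Ideal.span (X '' ((Fᶜ : Finset V) : Set V))
  have hPF : P = Ideal.span (X '' (F : Set V)ᶜ) := by rw [← Finset.coe_compl]
  let ε : MvPolynomial V K →+* K := eval fun v => if v ∈ F then 1 else 0
  let T := ModuleCat.of (MvPolynomial V K) (MvPolynomial V K ⧸ RingHom.ker ε)
  have hT (p q : MvPolynomial V K) (hpq : ε p = ε q) (t : T) : p • t = q • t := by
    obtain ⟨r, rfl⟩ := Ideal.Quotient.mk_surjective t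
    refine (Ideal.Quotient.eq (I := RingHom.ker ε)).mpr ?_
    change ε (p * r - q * r) = 0
    rw [map_sub, map_mul, map_mul, hpq, sub_self]
  have : Nontrivial T := Ideal.Quotient.nontrivial_iff.mpr (RingHom.ker_ne_top ε)
  refine not_subsingleton_ext_quotient_span_X_image (K := K) Fᶜ T (fun v hv t => ?_)
    (subsingleton_of_forall_eq 0 fun e => ?_)
  · rw [hT (X v) 0 (by simpa [ε] using hv), zero_smul]
  let g : Δ.StanleyReisnerRing K →ₗ[MvPolynomial V K] MvPolynomial V K ⧸ P :=
    Submodule.factor (hPF ▸ Δ.stanleyReisnerIdeal_le K hF.prop)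
  have hg : Function.Surjective g := Submodule.factor_surjective _
  have hS : g.shortComplexKer.ShortExact := LinearMap.shortExact_shortComplexKer hg
  -- The product `U` of the variables in `F` kills the kernel of `K[Δ] → R ⧸ P`, but acts as the
  -- identity on `T`.
  let U : MvPolynomial V K := ∏ y ∈ F, X y
  have hker (j : ℕ) (x : Ext g.shortComplexKer.X₁ T j) : x = 0 := by
    have hU : U • 𝟙 g.shortComplexKer.X₁ = 0 := by
      ext ⟨n, hn⟩
      obtain ⟨p, rfl⟩ := Ideal.Quotient.mk_surjective n
      have hp : p ∈ P := (Submodule.Quotient.mk_eq_zero P).mp hn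
      refine (Ideal.Quotient.eq_zero_iff_mem (a := U * p)).mpr ?_
      rw [mul_comm, Δ.mul_prod_mem_iff_of_isFacet K hF, ← hPF]
      exact hp
    rw [← one_smul (MvPolynomial V K) x, ext_smul_of_forall_smul_eq
      (hT 1 U (by simp +contextual [U, ε, Finset.prod_eq_one])), ← mk₀_smul_id_comp, hU,
      Ext.mk₀_zero, Ext.zero_comp]
  have he : (Ext.mk₀ g.shortComplexKer.g).comp e (zero_add _) = 0 :=
    (h.subsingleton _ _ _ le_rfl _).elim _ _
  generalize Fᶜ.card = b at e he
  cases b with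
  | zero => exact Ext.precomp_mk₀_injective_of_epi T _ (hg := hS.epi_g) (he.trans (map_zero _).symm)
  | succ b =>
    obtain ⟨y, rfl⟩ := Ext.contravariant_sequence_exact₃ hS T e he (add_comm 1 b)
    rw [hker b y, Ext.comp_zero]

lemma pdim_le [Finite V] : Δ.pdim K ≤ Nat.card V :=
  (projectiveDimension_le_iff _ _).mpr (hasProjectiveDimensionLE_mvPolynomial V K _)

lemma card_compl_le_pdim [Fintype V] [DecidableEq V] {F : Finset V} (hF : Δ.IsFacet F) :
    (Fᶜ.card : WithBot ℕ∞) ≤ Δ.pdim K :=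
  (projectiveDimension_ge_iff _ _).mpr (Δ.not_hasProjectiveDimensionLT_of_isFacet K hF)

/-- The **Auslander–Buchsbaum formula** for `K[Δ]`. -/
theorem depth_stanleyReisnerRing [Finite V] {p : ℕ} (hp : Δ.pdim K = p) :
    depth (MvPolynomial.idealOfVars V K) (Δ.StanleyReisnerRing K) = (Nat.card V - p : ℕ) := by
  have hpV : p ≤ Nat.card V := by exact_mod_cast hp ▸ Δ.pdim_le K
  apply le_antisymm
  · refine iSup₂_le fun rs hrs => ?_
    by_contra! hlt
    refine (projectiveDimension_ge_iff _ _).mp hp.ge (hasProjectiveDimensionLT_of_isWeaklyRegular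
      (Δ.gradingStanleyReisnerRing K) hrs.1 hrs.2 ?_)
    have : Nat.card V - p < rs.length := by exact_mod_cast hlt
    omega
  · obtain ⟨rs, hlen, hM, hrs⟩ := exists_isWeaklyRegular_of_hasProjectiveDimensionLE
      (ModuleCat.of _ (Δ.StanleyReisnerRing K)) (d := Nat.card V - p) (by omega)
      ((projectiveDimension_le_iff _ _).mp hp.le)
    rw [← hlen]
    exact le_iSup₂_of_le rs ⟨hM, hrs⟩ le_rfl

/-- `Δ` is initially Cohen–Macaulay if and only if the projective dimension of `K[Δ]` equals the
largest height of an associated prime. -/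
theorem isInitiallyCohenMacaulay_iff_pdim_eq [Fintype V] [DecidableEq V] {F : Finset V}
    (hF : Δ.IsMinimumFacet F) : Δ.IsInitiallyCohenMacaulay K ↔ Δ.pdim K = Fᶜ.card := by
  have hle := Δ.card_compl_le_pdim K hF.1
  have hns : ¬ Subsingleton (Δ.StanleyReisnerRing K) := fun h => by
    have h0 : HasProjectiveDimensionLT
        (ModuleCat.of (MvPolynomial V K) (Δ.StanleyReisnerRing K)) 0 :=
      (ModuleCat.isZero_of_subsingleton _).hasProjectiveDimensionLT_zero
    exact Δ.not_hasProjectiveDimensionLT_of_isFacet K hF.1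
      (hasProjectiveDimensionLT_of_ge _ 0 _ (Nat.zero_le _))
  obtain ⟨p, hp⟩ : ∃ p : ℕ, Δ.pdim K = p := by
    have hV := Δ.pdim_le K
    generalize Δ.pdim K = d at hle hV
    induction d with
    | bot => simp at hle
    | coe d =>
      induction d with
      | top => exact absurd (top_le_iff.mp (WithBot.coe_le_coe.mp hV)) (ENat.natCast_ne_top _)
      | coe d => exact ⟨d, rfl⟩
  have hpV := Δ.pdim_le K
  rw [hp] at hle hpV
  have h₁ : Fᶜ.card ≤ p := by exact_mod_cast hle
  have h₂ : p ≤ Nat.card V := by exact_mod_cast hpV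
  have h₃ := F.card_add_card_compl
  rw [← Nat.card_eq_fintype_card] at h₃
  rw [IsInitiallyCohenMacaulay, InitiallyCM.IsInitiallyCohenMacaulay, or_iff_right hns,
    Δ.depth_stanleyReisnerRing K hp, Δ.indim_stanleyReisnerRing K hF, hp]
  norm_cast
  omega

lemma exists_isMinimumFacet [Finite V] (h : ∅ ∈ Δ.faces) : ∃ F, Δ.IsMinimumFacet F := by
  obtain ⟨F₀, hF₀, -⟩ := Δ.exists_facet_ge h
  obtain ⟨F, hF, hmin⟩ := (Set.toFinite {F | Δ.IsFacet F}).exists_minimalFor Finset.card _ ⟨F₀, hF₀⟩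
  exact ⟨F, hF, fun F' hF' => (le_total _ _).elim id (hmin hF')⟩

end Complex

/-! ### Facets of the independence complex and vertex degrees -/

section Graph

variable {V : Type u} (G : SimpleGraph V)

lemma exists_facet_mem [Finite V] (x : V) :
    ∃ F, (independenceComplex G).IsFacet F ∧ x ∈ F := by
  obtain ⟨F, hF, hxF⟩ := (independenceComplex G).exists_facet_ge (A := {x}) (by
    simp [independenceComplex, SimpleGraph.IsIndepSet])
  exact ⟨F, hF, Finset.singleton_subset_iff.mp hxF⟩

variable [Fintype V] [DecidableEq V] [DecidableRel G.Adj] {G}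

lemma neighborFinset_subset_compl {F : Finset V} (hF : (independenceComplex G).IsFacet F) {x : V}
    (hx : x ∈ F) : G.neighborFinset x ⊆ Fᶜ := by
  intro y hy
  rw [SimpleGraph.mem_neighborFinset] at hy
  exact Finset.mem_compl.mpr fun hyF => hF.prop hx hyF hy.ne hy

lemma compl_subset_neighborFinset_of_isFreeVertex {F : Finset V}
    (hF : (independenceComplex G).IsFacet F) {x : V} (hx : x ∈ F)
    (hfree : (independenceComplex G).IsFreeVertex x) : Fᶜ ⊆ G.neighborFinset x := by
  intro y hy
  rw [SimpleGraph.mem_neighborFinset]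
  by_contra hxy
  obtain ⟨F', hF', hsub⟩ := (independenceComplex G).exists_facet_ge (A := {x, y}) (by
    simp [independenceComplex, SimpleGraph.IsIndepSet, Set.pairwise_pair, hxy, G.adj_comm y x])
  have hFF' : F' = F := hfree.unique ⟨hF', hsub (by simp)⟩ ⟨hF, hx⟩
  exact Finset.mem_compl.mp hy (hFF' ▸ hsub (by simp))

lemma maxDegree_le_card_compl [Nonempty V] {F : Finset V}
    (hF : (independenceComplex G).IsMinimumFacet F) : G.maxDegree ≤ Fᶜ.card := by
  obtain ⟨x, hx⟩ := G.exists_maximal_degree_vertex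
  obtain ⟨F', hF', hxF'⟩ := exists_facet_mem G x
  rw [hx, ← G.card_neighborFinset_eq_degree]
  refine (Finset.card_le_card (neighborFinset_subset_compl hF' hxF')).trans ?_
  rw [Finset.card_compl, Finset.card_compl]
  exact Nat.sub_le_sub_left (hF.2 F' hF') _

/-- A minimum facet contains a free vertex exactly if it is the complement of the neighbourhood of
a vertex, which then has maximum degree. -/
theorem exists_isFreeVertex_iff_maxDegree_eq [Nonempty V] {F : Finset V}
    (hF : (independenceComplex G).IsMinimumFacet F) :
    (∃ F, (independenceComplex G).IsMinimumFacet F ∧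
      ∃ x ∈ F, (independenceComplex G).IsFreeVertex x) ↔ G.maxDegree = Fᶜ.card := by
  constructor
  · rintro ⟨F', hF', x, hx, hfree⟩
    have h := Finset.card_le_card (compl_subset_neighborFinset_of_isFreeVertex hF'.1 hx hfree)
    have hcard : F'.card = F.card := le_antisymm (hF'.2 F hF.1) (hF.2 F' hF'.1)
    rw [Finset.card_compl, hcard, ← Finset.card_compl, G.card_neighborFinset_eq_degree] at h
    exact le_antisymm (maxDegree_le_card_compl hF) (h.trans (G.degree_le_maxDegree x))
  · intro h
    obtain ⟨x, hx⟩ := G.exists_maximal_degree_vertex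
    obtain ⟨F', hF', hxF'⟩ := exists_facet_mem G x
    have hcard : F'ᶜ.card ≤ (G.neighborFinset x).card := by
      rw [G.card_neighborFinset_eq_degree, ← hx, h, Finset.card_compl, Finset.card_compl]
      exact Nat.sub_le_sub_left (hF.2 F' hF') _
    have heq := Finset.eq_of_subset_of_card_le (neighborFinset_subset_compl hF' hxF') hcard
    have hle : F'.card ≤ F.card := by
      have h₀ : F'ᶜ.card = Fᶜ.card := by rw [← heq, G.card_neighborFinset_eq_degree, ← hx, h]
      have h₁ := F.card_add_card_compl
      have h₂ := F'.card_add_card_compl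
      omega
    refine ⟨F', ⟨hF', fun F'' hF'' => hle.trans (hF.2 F'' hF'')⟩, x, hxF', F', ⟨hF', hxF'⟩, ?_⟩
    rintro F'' ⟨hF'', hxF''⟩
    have hsub : F'' ⊆ F' := by
      rw [← Finset.compl_subset_compl, ← heq]
      exact neighborFinset_subset_compl hF'' hxF''
    exact hF''.eq_of_le hF'.prop hsub

end Graph

end InitiallyCM

theorem mainTheorem12 {V : Type*} [Fintype V] [Nonempty V] (G : SimpleGraph V)
    [DecidableRel G.Adj] (K : Type*) [Field K] :
    (InitiallyCM.independenceComplex G).pdim K = (G.maxDegree : WithBot ℕ∞) ↔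
      (InitiallyCM.independenceComplex G).IsInitiallyCohenMacaulay K ∧
        ∃ F, (InitiallyCM.independenceComplex G).IsMinimumFacet F ∧
          ∃ x ∈ F, (InitiallyCM.independenceComplex G).IsFreeVertex x := by
  classical
  obtain ⟨F, hF⟩ := (InitiallyCM.independenceComplex G).exists_isMinimumFacet (by
    simp [InitiallyCM.independenceComplex, SimpleGraph.IsIndepSet])
  rw [InitiallyCM.Complex.isInitiallyCohenMacaulay_iff_pdim_eq _ K hF,
    InitiallyCM.exists_isFreeVertex_iff_maxDegree_eq hF]
  have hdeg := InitiallyCM.maxDegree_le_card_compl hF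
  have hpdim := InitiallyCM.Complex.card_compl_le_pdim _ K hF.1
  constructor
  · intro h
    rw [h] at hpdim
    have heq : G.maxDegree = Fᶜ.card := le_antisymm hdeg (by exact_mod_cast hpdim)
    exact ⟨heq ▸ h, heq⟩
  · rintro ⟨h, heq⟩
    rw [h, heq]
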